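/- Let $n\ge 2$ and let $(\bar g_{ij}(r))_{i,j=2,\dots,n}$ be a symmetric, positive-definite matrix of smooth functions of $r\in\mathbb{R}$. Let $\mathscr{F}_{\bar g}$ be the set of all (smooth) Riemannian metrics on $\mathbb{R}^n=\{(r,x^2,\dots,x^n)\}$ of the form $$g_R=(dr)^2+g_{ij}(r,x^2,\dots,x^n)\,dx^i dx^j,\qquad g_{ij}(r,0,\dots,0)=\bar g_{ij}(r),$$ and on $\mathbb{R}^{n+1}=\{(r,t,\tilde x^2,\dots,\tilde x^n)\}$ let $h_{PW}=2\,dr\,dt+\bar g_{ij}(r)\,d\tilde x^i d\tilde x^j$. Repeated indices are summed over $2,\dots,n$. There is a smooth matrix function $C=(C^i_j(u))_{i,j=2,\dots,n}$, $u\in\mathbb{R}$, with $$C^i_k\,\bar g_{ij}\,C^j_l=\delta_{kl},\qquad (\partial_uC^i_k)\,\bar g_{ij}\,C^j_l=C^i_k\,\bar g_{ij}\,(\partial_uC^j_l).$$ For every such $C$, the formulas $$r=u,\qquad \tilde x^i=C^i_k(u)\,x^k,\qquad t=v-\tfrac12\,\bar g_{ij}(u)\,(\partial_uC^i_k)\,C^j_l\,x^kx^l$$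 define a global change of coordinates (a diffeomorphism of $\mathbb{R}^{n+1}$) to "Brinkmann coordinates" $(v,u,x^2,\dots,x^n)$, in which $$h_{PW}=2\,dv\,du+H\,(du)^2+\sum_{i=2}^n(dx^i)^2,\qquad H(u,x^2,\dots,x^n)=-\partial_u\big(\bar g_{ij}(u)\,\partial_uC^i_k(u)\big)\,C^j_l(u)\,x^kx^l .$$ Let $\Delta H$ be the Euclidean Laplacian of $H$ with respect to $x^2,\dots,x^n$, and $H_{iju}=\partial_u\partial_{x^i}\partial_{x^j}H$. Then, where "$\neq 0$" means "not identically zero": 1. If $\partial_u(\Delta H)\neq0$, then no $g_R\in\mathscr{F}_{\bar g}$ has parallel Ricci tensor ($\nabla\mathrm{Ric}=0$ on $\mathbb{R}^n$). 2. If $\Delta H\neq0$, then no $g_R\in\mathscr{F}_{\bar g}$ is Ricci-flat. 3. If $H_{iju}\neq0$ for some $i,j\in\{2,\dots,n\}$, then no $g_R\in\mathscr{F}_{\bar g}$ is locally symmetric ($\nabla\mathrm{Rm}=0$ on $\mathbb{R}^n$). -/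

import Mathlib

open scoped ContDiff

noncomputable section

namespace PlaneWave

/-! ### Metrics and curvature in a global chart

Everything takes place on the coordinate space `ι → ℝ` with its standard global chart; a (possibly
indefinite) metric is the matrix field of its components. -/

section Curvature

variable {ι : Type*} [Fintype ι] [DecidableEq ι]

/-- The partial derivative `∂f/∂xⁱ` at the point `p`. -/
def partialD (i : ι) (f : (ι → ℝ) → ℝ) (p : ι → ℝ) : ℝ :=
  fderiv ℝ f p (Pi.single i 1)

/-- A smooth Riemannian metric on `ℝ^ι`: smooth components and a symmetric positive-definite
matrix at each point. -/
structure IsRiemannianMetric (g : (ι → ℝ) → Matrix ι ι ℝ) : Prop where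
  smooth : ∀ i j, ContDiff ℝ ∞ fun p => g p i j
  posDef : ∀ p, (g p).PosDef

/-- Christoffel symbols `Γᵏ_{ij} = ½ gᵏˡ (∂_i g_{jl} + ∂_j g_{il} - ∂_l g_{ij})` of the Levi-Civita
connection. -/
def christoffel (g : (ι → ℝ) → Matrix ι ι ℝ) (k i j : ι) (p : ι → ℝ) : ℝ :=
  (1 / 2) * ∑ l, (g p)⁻¹ k l *
    (partialD i (fun q => g q j l) p + partialD j (fun q => g q i l) p
      - partialD l (fun q => g q i j) p)

/-- Components of the curvature endomorphism: `R(∂_i, ∂_j) ∂_k = ∑_l (curvEndo g i j k l) ∂_l`, where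
`R(X, Y) Z = ∇_X ∇_Y Z - ∇_Y ∇_X Z - ∇_{[X, Y]} Z`. -/
def curvEndo (g : (ι → ℝ) → Matrix ι ι ℝ) (i j k l : ι) (p : ι → ℝ) : ℝ :=
  partialD i (christoffel g l j k) p - partialD j (christoffel g l i k) p
    + ∑ m, (christoffel g l i m p * christoffel g m j k p
      - christoffel g l j m p * christoffel g m i k p)

/-- The curvature 4-tensor `Rm_{ijkl} = g(R(∂_i, ∂_j) ∂_k, ∂_l)`. -/
def riem (g : (ι → ℝ) → Matrix ι ι ℝ) (i j k l : ι) (p : ι → ℝ) : ℝ :=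
  ∑ m, curvEndo g i j k m p * g p m l

/-- The Ricci tensor `Ric_{jk} = tr (Z ↦ R(Z, ∂_j) ∂_k)`. -/
def ricci (g : (ι → ℝ) → Matrix ι ι ℝ) (j k : ι) (p : ι → ℝ) : ℝ :=
  ∑ i, curvEndo g i j k i p

/-- The components `(∇_a Rm)_{ijkl}` of the covariant derivative of the curvature 4-tensor. -/
def covDerivRiem (g : (ι → ℝ) → Matrix ι ι ℝ) (a i j k l : ι) (p : ι → ℝ) : ℝ :=
  partialD a (riem g i j k l) p
    - ∑ m, (christoffel g m a i p * riem g m j k l p + christoffel g m a j p * riem g i m k l p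
      + christoffel g m a k p * riem g i j m l p + christoffel g m a l p * riem g i j k m p)

/-- The components `(∇_a Ric)_{jk}` of the covariant derivative of the Ricci tensor. -/
def covDerivRicci (g : (ι → ℝ) → Matrix ι ι ℝ) (a j k : ι) (p : ι → ℝ) : ℝ :=
  partialD a (ricci g j k) p
    - ∑ m, (christoffel g m a j p * ricci g m k p + christoffel g m a k p * ricci g j m p)

/-- `Ric = 0`. -/
def RicciFlat (g : (ι → ℝ) → Matrix ι ι ℝ) : Prop :=
  ∀ j k p, ricci g j k p = 0

/-- `∇ Ric = 0`. -/
def ParallelRicci (g : (ι → ℝ) → Matrix ι ι ℝ) : Prop :=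
  ∀ a j k p, covDerivRicci g a j k p = 0

/-- `∇ Rm = 0`. -/
def LocallySymmetric (g : (ι → ℝ) → Matrix ι ι ℝ) : Prop :=
  ∀ a i j k l p, covDerivRiem g a i j k l p = 0

/-- The pullback `Φ^* g` of a metric along a map between coordinate spaces. -/
def pullbackMetric (Φ : (ι → ℝ) → (ι → ℝ)) (g : (ι → ℝ) → Matrix ι ι ℝ) :
    (ι → ℝ) → Matrix ι ι ℝ := fun p => Matrix.of fun a b =>
  ∑ c, ∑ d, g (Φ p) c d * partialD a (fun q => Φ q c) p * partialD b (fun q => Φ q d) p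

/-- `Φ` is a smooth diffeomorphism of `ℝ^ι` onto itself, that is, a global change of coordinates. -/
def IsSmoothDiffeo (Φ : (ι → ℝ) → (ι → ℝ)) : Prop :=
  ContDiff ℝ ∞ Φ ∧ ∃ Ψ : (ι → ℝ) → (ι → ℝ), ContDiff ℝ ∞ Ψ ∧
    Function.LeftInverse Ψ Φ ∧ Function.RightInverse Ψ Φ

end Curvature

/-! ### Riemannian extensions, plane waves and Brinkmann coordinates

`ℝⁿ = {(r, x², …, xⁿ)}` with `n = m + 1` is `Fin 1 ⊕ Fin m → ℝ` (first `r`, then the `x`'s), and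
`ℝⁿ⁺¹` is `Fin 2 ⊕ Fin m → ℝ`, with coordinates `(r, t, x)` (Rosen) or `(v, u, x)` (Brinkmann). -/

section Wave

variable {m : ℕ}

/-- The set of all Riemannian metrics on `ℝⁿ` of the form `(dr)² + g_{ij}(r, x) dxⁱ dxʲ` such that
`g_{ij}(r, 0) = gbar_{ij}(r)`. -/
def riemannianExtensions (gbar : ℝ → Matrix (Fin m) (Fin m) ℝ) :
    Set ((Fin 1 ⊕ Fin m → ℝ) → Matrix (Fin 1 ⊕ Fin m) (Fin 1 ⊕ Fin m) ℝ) :=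
  {g | IsRiemannianMetric g ∧
    ∃ γ : (Fin 1 ⊕ Fin m → ℝ) → Matrix (Fin m) (Fin m) ℝ,
      (∀ p, g p = Matrix.fromBlocks 1 0 0 (γ p)) ∧
      ∀ r : ℝ, γ (Sum.elim (fun _ => r) (fun _ => 0)) = gbar r}

/-- The plane wave metric `2 dr dt + gbar_{ij}(r) dxⁱ dxʲ` in the coordinates `(r, t, x)`. -/
def planeWave (gbar : ℝ → Matrix (Fin m) (Fin m) ℝ) :
    (Fin 2 ⊕ Fin m → ℝ) → Matrix (Fin 2 ⊕ Fin m) (Fin 2 ⊕ Fin m) ℝ :=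
  fun p => Matrix.fromBlocks !![0, 1; 1, 0] 0 0 (gbar (p (Sum.inl 0)))

/-- The metric `2 dv du + H(u, x) (du)² + ∑ (dxⁱ)²` in the coordinates `(v, u, x)`. -/
def brinkmannMetric (H : ℝ → EuclideanSpace ℝ (Fin m) → ℝ) :
    (Fin 2 ⊕ Fin m → ℝ) → Matrix (Fin 2 ⊕ Fin m) (Fin 2 ⊕ Fin m) ℝ :=
  fun p => Matrix.fromBlocks
    !![0, 1; 1, H (p (Sum.inl 1)) (WithLp.toLp 2 fun i => p (Sum.inr i))] 0 0 1

/-- The entrywise derivative of a matrix-valued function of one variable. -/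
def matDeriv (C : ℝ → Matrix (Fin m) (Fin m) ℝ) (u : ℝ) : Matrix (Fin m) (Fin m) ℝ :=
  Matrix.of fun i k => deriv (fun s => C s i k) u

/-- The smooth matrix functions `C` that define the passage to Brinkmann coordinates:
`Cⁱ_k gbar_{ij} Cʲ_l = δ_{kl}` and `(∂_u Cⁱ_k) gbar_{ij} Cʲ_l = Cⁱ_k gbar_{ij} (∂_u Cʲ_l)`. -/
structure IsBrinkmannFrame (gbar C : ℝ → Matrix (Fin m) (Fin m) ℝ) : Prop where
  smooth : ∀ i k, ContDiff ℝ ∞ fun u => C u i k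
  orthonormal : ∀ u, (C u).transpose * gbar u * C u = 1
  symm : ∀ u, (matDeriv C u).transpose * gbar u * C u = (C u).transpose * gbar u * matDeriv C u

/-- The change of coordinates from Brinkmann coordinates `(v, u, x)` to Rosen coordinates:
`r = u`, `t = v - ½ gbar_{ij}(u) (∂_u Cⁱ_k) Cʲ_l xᵏ xˡ`, and the `i`-th transverse Rosen coordinate
is `Cⁱ_k(u) xᵏ`. -/
def brinkmannToRosen (gbar C : ℝ → Matrix (Fin m) (Fin m) ℝ) (p : Fin 2 ⊕ Fin m → ℝ) :
    Fin 2 ⊕ Fin m → ℝ :=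
  Sum.elim
    ![p (Sum.inl 1),
      p (Sum.inl 0) - (1 / 2) * ∑ i, ∑ j, ∑ k, ∑ l, gbar (p (Sum.inl 1)) i j *
        matDeriv C (p (Sum.inl 1)) i k * C (p (Sum.inl 1)) j l * p (Sum.inr k) * p (Sum.inr l)]
    (fun i => ∑ k, C (p (Sum.inl 1)) i k * p (Sum.inr k))

/-- The profile `H(u, x) = -∂_u (gbar_{ij}(u) ∂_u Cⁱ_k(u)) Cʲ_l(u) xᵏ xˡ`. -/
def profile (gbar C : ℝ → Matrix (Fin m) (Fin m) ℝ) (u : ℝ) (x : EuclideanSpace ℝ (Fin m)) : ℝ :=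
  -∑ j, ∑ k, ∑ l, deriv (fun s => ∑ i, gbar s i j * matDeriv C s i k) u * C u j l * x k * x l

/-- The second partial derivative `H_{ij} = ∂²H/∂xⁱ∂xʲ` at `(u, x)`. -/
def spatialHessian (H : ℝ → EuclideanSpace ℝ (Fin m) → ℝ) (i j : Fin m) (u : ℝ)
    (x : EuclideanSpace ℝ (Fin m)) : ℝ :=
  iteratedFDeriv ℝ 2 (H u) x ![EuclideanSpace.single i 1, EuclideanSpace.single j 1]

end Wave

end PlaneWave

end

/-!
A Brinkmann frame is an orthonormal frame of the slices that is parallel along the `r`-lines: with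
the shape operator `B = ½ gbar⁻¹ gbar'`, the two frame conditions say exactly that `C' = -B C` and
that `C` is orthonormal at one point. For such a frame the profile is `H = -xᵀ N x` with
`N = Cᵀ J C`, where by the Riccati equation `J = gbar(R(·, ∂_r) ∂_r, ·)` is the Jacobi form of
`dr² + gbar`. The `r`-lines of any extension `g_R` are geodesics, and the Christoffel symbols and
curvatures entering `J` involve only derivatives along them, so `J` and its covariant derivative
along the axis are the same for all extensions. Hence `ΔH = -2 Ric_rr`, `∂_u ΔH = -2 (∇_r Ric)_rr`
and `∂_u N = Cᵀ (∇_r J) C`, which vanish as soon as `Ric`, `∇ Ric` or `∇ Rm` does.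
-/

noncomputable section

namespace PlaneWave

section LinearODE

open MeasureTheory

variable {E : Type*} [NormedAddCommGroup E] [NormedSpace ℝ E] {A : ℝ → E →L[ℝ] E}

/-- The `n`-th term of the Picard series, whose sum solves the linear differential equation
`X' = A X` with initial value `X t₀ = x₀`. -/
def picardTerm (A : ℝ → E →L[ℝ] E) (t₀ : ℝ) (x₀ : E) : ℕ → ℝ → E
  | 0 => fun _ => x₀
  | n + 1 => fun t => ∫ s in t₀..t, A s (picardTerm A t₀ x₀ n s)

theorem continuous_picardTerm (hA : Continuous A) (t₀ : ℝ) (x₀ : E) (n : ℕ) :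
    Continuous (picardTerm A t₀ x₀ n) := by
  induction n with
  | zero => exact continuous_const
  | succ n ih =>
    exact intervalIntegral.continuous_primitive
      (fun a b => (hA.clm_apply ih).intervalIntegrable a b) t₀

theorem hasDerivAt_picardTerm_succ [CompleteSpace E] (hA : Continuous A) (t₀ : ℝ) (x₀ : E) (n : ℕ)
    (t : ℝ) : HasDerivAt (picardTerm A t₀ x₀ (n + 1)) (A t (picardTerm A t₀ x₀ n t)) t :=
  ((hA.clm_apply (continuous_picardTerm hA t₀ x₀ n)).integral_hasStrictDerivAt t₀ t).hasDerivAt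

theorem norm_picardTerm_le (hA : Continuous A) (x₀ : E) {t₀ t M : ℝ}
    (hM : ∀ s ∈ Set.uIcc t₀ t, ‖A s‖ ≤ M) (n : ℕ) :
    ‖picardTerm A t₀ x₀ n t‖ ≤ ‖x₀‖ * ((M * |t - t₀|) ^ n / n.factorial) := by
  have hM0 : 0 ≤ M := (norm_nonneg _).trans (hM t Set.right_mem_uIcc)
  induction n generalizing t with
  | zero => simp [picardTerm]
  | succ n ih =>
    have integrand_le : ∀ s ∈ Set.uIoc t₀ t, ‖A s (picardTerm A t₀ x₀ n s)‖ ≤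
        ‖x₀‖ * M * (M ^ n / n.factorial) * |s - t₀| ^ n := fun s hs => by
      have hs' : s ∈ Set.uIcc t₀ t := Set.uIoc_subset_uIcc hs
      calc ‖A s (picardTerm A t₀ x₀ n s)‖ ≤ ‖A s‖ * ‖picardTerm A t₀ x₀ n s‖ := (A s).le_opNorm _
        _ ≤ M * (‖x₀‖ * ((M * |s - t₀|) ^ n / n.factorial)) := by
          gcongr
          · exact hM s hs'
          · exact ih fun r hr => hM r (Set.uIcc_subset_uIcc_left hs' hr)
        _ = ‖x₀‖ * M * (M ^ n / n.factorial) * |s - t₀| ^ n := by rw [mul_pow]; ring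
    calc ‖picardTerm A t₀ x₀ (n + 1) t‖
        ≤ ∫ s in Set.uIoc t₀ t, ‖A s (picardTerm A t₀ x₀ n s)‖ :=
          intervalIntegral.norm_integral_le_integral_norm_uIoc
      _ ≤ ∫ s in Set.uIoc t₀ t, ‖x₀‖ * M * (M ^ n / n.factorial) * |s - t₀| ^ n :=
          setIntegral_mono_on
            ((hA.clm_apply (continuous_picardTerm hA t₀ x₀ n)).norm.intervalIntegrable t₀ t).def'
            (Continuous.intervalIntegrable (by fun_prop) t₀ t).def' measurableSet_uIoc integrand_le
      _ = ‖x₀‖ * ((M * |t - t₀|) ^ (n + 1) / (n + 1).factorial) := by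
          rw [integral_const_mul, integral_pow_abs_sub_uIoc, Nat.factorial_succ, mul_pow]
          push_cast
          field_simp
          ring

theorem exists_summable_norm_picardTerm_le (hA : Continuous A) (t₀ : ℝ) (x₀ : E) (T : ℝ) :
    ∃ b : ℕ → ℝ, Summable b ∧
      ∀ n, ∀ t ∈ Metric.ball t₀ T, ‖picardTerm A t₀ x₀ n t‖ ≤ b n := by
  obtain ⟨M, hM⟩ := (isCompact_closedBall t₀ T).exists_bound_of_continuousOn hA.continuousOn
  refine ⟨fun n => ‖x₀‖ * ((M * T) ^ n / n.factorial),
    (Real.summable_pow_div_factorial (M * T)).mul_left _, fun n t ht => ?_⟩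
  have ht' : t ∈ Metric.closedBall t₀ T := Metric.ball_subset_closedBall ht
  have hT : |t - t₀| ≤ T := ht'
  have hM0 : 0 ≤ M := (norm_nonneg _).trans (hM t ht')
  have segment_subset : Set.uIcc t₀ t ⊆ Metric.closedBall t₀ T := by
    rw [← segment_eq_uIcc]
    exact (convex_closedBall t₀ T).segment_subset
      (Metric.mem_closedBall_self ((abs_nonneg _).trans hT)) ht'
  calc ‖picardTerm A t₀ x₀ n t‖ ≤ ‖x₀‖ * ((M * |t - t₀|) ^ n / n.factorial) :=
        norm_picardTerm_le hA x₀ (fun s hs => hM s (segment_subset hs)) n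
    _ ≤ ‖x₀‖ * ((M * T) ^ n / n.factorial) := by gcongr

theorem summable_picardTerm [CompleteSpace E] (hA : Continuous A) (t₀ : ℝ) (x₀ : E) (t : ℝ) :
    Summable fun n => picardTerm A t₀ x₀ n t := by
  obtain ⟨b, hb, hle⟩ := exists_summable_norm_picardTerm_le hA t₀ x₀ (|t - t₀| + 1)
  exact .of_norm_bounded hb fun n => hle n t (by simp [Real.dist_eq])

theorem hasDerivAt_tsum_picardTerm [CompleteSpace E] (hA : Continuous A) (t₀ : ℝ) (x₀ : E)
    (t : ℝ) :
    HasDerivAt (fun s => ∑' n, picardTerm A t₀ x₀ n s) (A t (∑' n, picardTerm A t₀ x₀ n t)) t := by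
  set T := |t - t₀| + 1
  have ht : t ∈ Metric.ball t₀ T := by simp [T, Real.dist_eq]
  obtain ⟨M, hM⟩ := (isCompact_closedBall t₀ T).exists_bound_of_continuousOn hA.continuousOn
  obtain ⟨b, hb, hle⟩ := exists_summable_norm_picardTerm_le hA t₀ x₀ T
  have tail : HasDerivAt (fun s => ∑' n, picardTerm A t₀ x₀ (n + 1) s)
      (∑' n, A t (picardTerm A t₀ x₀ n t)) t := by
    refine hasDerivAt_tsum_of_isPreconnected (hb.mul_left M) Metric.isOpen_ball
      (convex_ball t₀ T).isPreconnected (fun n s _ => hasDerivAt_picardTerm_succ hA t₀ x₀ n s)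
      (fun n s hs => ?_) ht ((summable_nat_add_iff 1).2 (summable_picardTerm hA t₀ x₀ t)) ht
    exact (A s).le_of_opNorm_le_of_le (hM s (Metric.ball_subset_closedBall hs)) (hle n s hs)
  rw [(A t).map_tsum (summable_picardTerm hA t₀ x₀ t)]
  refine (tail.const_add x₀).congr_of_eventuallyEq (.of_forall fun s => ?_)
  exact (summable_picardTerm hA t₀ x₀ s).tsum_eq_zero_add

theorem exists_forall_hasDerivAt_clm [CompleteSpace E] (hA : Continuous A) (t₀ : ℝ) (x₀ : E) :
    ∃ X : ℝ → E, X t₀ = x₀ ∧ ∀ t, HasDerivAt X (A t (X t)) t := by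
  refine ⟨fun t => ∑' n, picardTerm A t₀ x₀ n t, ?_, hasDerivAt_tsum_picardTerm hA t₀ x₀⟩
  refine (tsum_eq_single 0 fun n hn => ?_).trans rfl
  obtain ⟨n, rfl⟩ := Nat.exists_eq_succ_of_ne_zero hn
  exact intervalIntegral.integral_same

theorem contDiff_of_hasDerivAt_clm (hA : ContDiff ℝ ∞ A) {X : ℝ → E}
    (hX : ∀ t, HasDerivAt X (A t (X t)) t) : ContDiff ℝ ∞ X := by
  refine contDiff_infty.2 fun n => ?_
  induction n with
  | zero => exact contDiff_zero.2 (continuous_iff_continuousAt.2 fun t => (hX t).continuousAt)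
  | succ n ih =>
    refine (contDiff_succ_iff_deriv (n := (n : WithTop ℕ∞))).2
      ⟨fun t => (hX t).differentiableAt, by simp, ?_⟩
    rw [funext fun t => (hX t).deriv]
    exact (contDiff_infty.1 hA n).clm_apply ih

end LinearODE

section MatrixCalculus

open Matrix

variable {E F ι κ ν : Type*} [NormedAddCommGroup E] [NormedSpace ℝ E]
  [NormedAddCommGroup F] [NormedSpace ℝ F]

/-- A matrix-valued function with smooth entries. Smoothness is spelled out entrywise because
matrices carry no canonical norm. -/
def IsSmoothMatrix (A : E → Matrix ι κ ℝ) : Prop :=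
  ∀ i j, ContDiff ℝ ∞ fun p => A p i j

namespace IsSmoothMatrix

variable {A : E → Matrix ι κ ℝ} {B : E → Matrix ι κ ℝ}

theorem const (M : Matrix ι κ ℝ) : IsSmoothMatrix fun _ : E => M :=
  fun _ _ => contDiff_const

theorem comp (hA : IsSmoothMatrix A) {f : F → E} (hf : ContDiff ℝ ∞ f) :
    IsSmoothMatrix fun p => A (f p) :=
  fun i j => (hA i j).comp hf

theorem transpose (hA : IsSmoothMatrix A) : IsSmoothMatrix fun p => (A p)ᵀ :=
  fun i j => hA j i

theorem neg (hA : IsSmoothMatrix A) : IsSmoothMatrix fun p => -A p :=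
  fun i j => (hA i j).neg

theorem add (hA : IsSmoothMatrix A) (hB : IsSmoothMatrix B) : IsSmoothMatrix fun p => A p + B p :=
  fun i j => (hA i j).add (hB i j)

theorem const_smul (hA : IsSmoothMatrix A) (c : ℝ) : IsSmoothMatrix fun p => c • A p :=
  fun i j => (hA i j).const_smul c

theorem mul [Fintype κ] (hA : IsSmoothMatrix A) {D : E → Matrix κ ν ℝ} (hD : IsSmoothMatrix D) :
    IsSmoothMatrix fun p => A p * D p := fun i j => by
  simp only [mul_apply]
  exact ContDiff.sum fun k _ => (hA i k).mul (hD k j)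

theorem mulVec [Fintype ι] [Fintype κ] (hA : IsSmoothMatrix A) {x : E → κ → ℝ}
    (hx : ContDiff ℝ ∞ x) : ContDiff ℝ ∞ fun p => A p *ᵥ x p :=
  contDiff_pi.2 fun i => ContDiff.sum fun k _ => (hA i k).mul (contDiff_pi.1 hx k)

theorem fromBlocks {ι' κ' : Type*} {D : E → Matrix ι' κ' ℝ} (hA : IsSmoothMatrix A)
    (hD : IsSmoothMatrix D) : IsSmoothMatrix fun p => Matrix.fromBlocks (A p) 0 0 (D p) := by
  rintro (i | i) (j | j)
  exacts [hA i j, contDiff_const, contDiff_const, hD i j]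

theorem det [Fintype ι] [DecidableEq ι] {A : E → Matrix ι ι ℝ} (hA : IsSmoothMatrix A) :
    ContDiff ℝ ∞ fun p => (A p).det := by
  simp only [det_apply']
  exact ContDiff.sum fun σ _ => contDiff_const.mul (contDiff_prod fun i _ => hA _ _)

theorem inv [Fintype ι] [DecidableEq ι] {A : E → Matrix ι ι ℝ} (hA : IsSmoothMatrix A)
    (h : ∀ p, IsUnit (A p)) : IsSmoothMatrix fun p => (A p)⁻¹ := fun i j => by
  have det_ne_zero : ∀ p, (A p).det ≠ 0 := fun p => ((isUnit_iff_isUnit_det _).1 (h p)).ne_zero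
  have cofactor : IsSmoothMatrix fun p => (A p).updateRow j (Pi.single i 1) := fun k l => by
    by_cases hk : k = j
    · subst hk
      simpa only [updateRow_self] using contDiff_const
    · simpa only [updateRow_ne hk] using hA k l
  simp only [inv_def, Matrix.smul_apply, Ring.inverse_eq_inv', smul_eq_mul, adjugate_apply]
  exact (hA.det.inv det_ne_zero).mul cofactor.det

end IsSmoothMatrix

theorem contDiff_dotProduct [Fintype ι] {x y : E → ι → ℝ} (hx : ContDiff ℝ ∞ x)
    (hy : ContDiff ℝ ∞ y) : ContDiff ℝ ∞ fun p => x p ⬝ᵥ y p :=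
  ContDiff.sum fun i _ => (contDiff_pi.1 hx i).mul (contDiff_pi.1 hy i)

theorem hasDerivAt_dotProduct [Fintype ι] {x y : ℝ → ι → ℝ} {x' y' : ι → ℝ} {t : ℝ}
    (hx : HasDerivAt x x' t) (hy : HasDerivAt y y' t) :
    HasDerivAt (fun s => x s ⬝ᵥ y s) (x' ⬝ᵥ y t + x t ⬝ᵥ y') t := by
  rw [dotProduct, dotProduct, ← Finset.sum_add_distrib]
  exact HasDerivAt.fun_sum fun i _ => (hasDerivAt_pi.1 hx i).mul (hasDerivAt_pi.1 hy i)

variable {m : ℕ} {A B : ℝ → Matrix (Fin m) (Fin m) ℝ}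

theorem IsSmoothMatrix.matDeriv (hA : IsSmoothMatrix A) : IsSmoothMatrix (matDeriv A) :=
  fun i j => (contDiff_infty_iff_deriv.1 (hA i j)).2

theorem IsSmoothMatrix.hasDerivAt (hA : IsSmoothMatrix A) (u : ℝ) (i j : Fin m) :
    HasDerivAt (fun s => A s i j) (PlaneWave.matDeriv A u i j) u :=
  ((hA i j).differentiable (by simp) u).hasDerivAt

theorem matDeriv_eq_of_hasDerivAt {A' : Matrix (Fin m) (Fin m) ℝ} {u : ℝ}
    (h : ∀ i j, HasDerivAt (fun s => A s i j) (A' i j) u) : matDeriv A u = A' :=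
  Matrix.ext fun i j => (h i j).deriv

theorem matDeriv_mul (hA : IsSmoothMatrix A) (hB : IsSmoothMatrix B) (u : ℝ) :
    matDeriv (fun s => A s * B s) u = matDeriv A u * B u + A u * matDeriv B u := by
  refine matDeriv_eq_of_hasDerivAt fun i j => ?_
  simp only [Matrix.add_apply, mul_apply, ← Finset.sum_add_distrib]
  exact HasDerivAt.fun_sum fun k _ => (hA.hasDerivAt u i k).mul (hB.hasDerivAt u k j)

theorem matDeriv_transpose (A : ℝ → Matrix (Fin m) (Fin m) ℝ) (u : ℝ) :
    matDeriv (fun s => (A s)ᵀ) u = (matDeriv A u)ᵀ := rfl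

theorem matDeriv_neg (A : ℝ → Matrix (Fin m) (Fin m) ℝ) (u : ℝ) :
    matDeriv (fun s => -A s) u = -matDeriv A u := by
  ext i j
  exact deriv.fun_neg

theorem matDeriv_const (M : Matrix (Fin m) (Fin m) ℝ) (u : ℝ) : matDeriv (fun _ => M) u = 0 :=
  matDeriv_eq_of_hasDerivAt fun _ _ => hasDerivAt_const u _

theorem eq_of_matDeriv_eq_zero (hA : IsSmoothMatrix A) (h : ∀ u, matDeriv A u = 0) (s t : ℝ) :
    A s = A t := by
  ext i j
  exact is_const_of_deriv_eq_zero ((hA i j).differentiable (by simp))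
    (fun u => congrFun₂ (h u) i j) s t

theorem hasDerivAt_mulVec (hA : IsSmoothMatrix A) {f : ℝ → ℝ} {x : ℝ → Fin m → ℝ} {f' t : ℝ}
    {x' : Fin m → ℝ} (hf : HasDerivAt f f' t) (hx : HasDerivAt x x' t) :
    HasDerivAt (fun s => A (f s) *ᵥ x s) (f' • matDeriv A (f t) *ᵥ x t + A (f t) *ᵥ x') t := by
  refine hasDerivAt_pi.2 fun i => ?_
  have row : HasDerivAt (fun s => (A (f s)).row i) (f' • (matDeriv A (f t)).row i) t :=
    hasDerivAt_pi.2 fun k => (hA.hasDerivAt (f t) i k).scomp t hf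
  rw [Pi.add_apply, Pi.smul_apply, Matrix.mulVec, Matrix.mulVec, ← smul_dotProduct]
  exact hasDerivAt_dotProduct row hx

theorem exists_matDeriv_eq_mul (hA : IsSmoothMatrix A) (t₀ : ℝ) (X₀ : Matrix (Fin m) (Fin m) ℝ) :
    ∃ X, IsSmoothMatrix X ∧ X t₀ = X₀ ∧ ∀ u, matDeriv X u = A u * X u := by
  let L : ℝ → (Fin m → ℝ) →L[ℝ] (Fin m → ℝ) := fun u => (A u).mulVecLin.toContinuousLinearMap
  have hL : ContDiff ℝ ∞ L := contDiff_clm_apply_iff.2 fun y =>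
    hA.mulVec (x := fun _ => y) contDiff_const
  choose col hcol₀ hcol using fun k => exists_forall_hasDerivAt_clm hL.continuous t₀ (X₀.col k)
  refine ⟨fun u => of fun i k => col k u i,
    fun i k => contDiff_pi.1 (contDiff_of_hasDerivAt_clm hL (hcol k)) i, ?_, fun u => ?_⟩
  · ext i k
    exact congrFun (hcol₀ k) i
  · exact matDeriv_eq_of_hasDerivAt fun i k => hasDerivAt_pi.1 (hcol k u) i

end MatrixCalculus

section BrinkmannFrames

open Matrix

/-- A smooth field of symmetric invertible matrices, that is, the components of a smooth metric of
arbitrary signature. -/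
structure IsSmoothMetric {E ι : Type*} [NormedAddCommGroup E] [NormedSpace ℝ E] [Fintype ι]
    [DecidableEq ι] (g : E → Matrix ι ι ℝ) : Prop where
  smooth : IsSmoothMatrix g
  isSymm : ∀ p, (g p).IsSymm
  isUnit : ∀ p, IsUnit (g p)

variable {m : ℕ} {gbar C W : ℝ → Matrix (Fin m) (Fin m) ℝ}

/-- The shape operator `B = ½ gbar⁻¹ gbar'` of the slices of constant `r` in the metric
`dr² + gbar(r)`. -/
def shapeOp (gbar : ℝ → Matrix (Fin m) (Fin m) ℝ) (r : ℝ) : Matrix (Fin m) (Fin m) ℝ :=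
  (1 / 2 : ℝ) • ((gbar r)⁻¹ * matDeriv gbar r)

/-- The Jacobi operator `Z ↦ R(Z, ∂_r) ∂_r` of the metric `dr² + gbar(r)`, expressed through the
shape operator by the Riccati equation. -/
def jacobiOp (gbar : ℝ → Matrix (Fin m) (Fin m) ℝ) (r : ℝ) : Matrix (Fin m) (Fin m) ℝ :=
  -(matDeriv (shapeOp gbar) r + shapeOp gbar r * shapeOp gbar r)

/-- The bilinear form `gbar(R(·, ∂_r) ∂_r, ·)` of the Jacobi operator. -/
def jacobiForm (gbar : ℝ → Matrix (Fin m) (Fin m) ℝ) (r : ℝ) : Matrix (Fin m) (Fin m) ℝ :=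
  (jacobiOp gbar r)ᵀ * gbar r

/-- The covariant derivative along `∂_r`, in the metric `dr² + gbar(r)`, of a bilinear form `W` on
the slices of constant `r`. -/
def covDerivForm (gbar W : ℝ → Matrix (Fin m) (Fin m) ℝ) (r : ℝ) : Matrix (Fin m) (Fin m) ℝ :=
  matDeriv W r - (shapeOp gbar r)ᵀ * W r - W r * shapeOp gbar r

/-- The matrix `N` of the quadratic form `-H`, where `H` is the profile of a Brinkmann frame. -/
def profileMatrix (gbar C : ℝ → Matrix (Fin m) (Fin m) ℝ) (u : ℝ) : Matrix (Fin m) (Fin m) ℝ :=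
  (matDeriv (fun s => gbar s * matDeriv C s) u)ᵀ * C u

namespace IsSmoothMetric

variable (h : IsSmoothMetric gbar)
include h

theorem isSmoothMatrix_shapeOp : IsSmoothMatrix (shapeOp gbar) :=
  ((h.smooth.inv h.isUnit).mul h.smooth.matDeriv).const_smul _

theorem isSmoothMatrix_jacobiOp : IsSmoothMatrix (jacobiOp gbar) :=
  (h.isSmoothMatrix_shapeOp.matDeriv.add
    (h.isSmoothMatrix_shapeOp.mul h.isSmoothMatrix_shapeOp)).neg

theorem isSmoothMatrix_jacobiForm : IsSmoothMatrix (jacobiForm gbar) :=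
  h.isSmoothMatrix_jacobiOp.transpose.mul h.smooth

theorem matDeriv_eq_two_smul (r : ℝ) : matDeriv gbar r = (2 : ℝ) • (gbar r * shapeOp gbar r) := by
  rw [shapeOp, Matrix.mul_smul, smul_smul,
    mul_nonsing_inv_cancel_left _ _ ((isUnit_iff_isUnit_det _).1 (h.isUnit r))]
  norm_num

theorem isSymm_mul_shapeOp (r : ℝ) : (gbar r * shapeOp gbar r).IsSymm := by
  have hderiv : (matDeriv gbar r).IsSymm := by
    rw [Matrix.IsSymm, ← matDeriv_transpose, funext h.isSymm]
  rw [h.matDeriv_eq_two_smul] at hderiv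
  simpa only [smul_smul, one_div, inv_mul_cancel₀ (two_ne_zero' ℝ), one_smul] using
    hderiv.smul (1 / 2 : ℝ)

end IsSmoothMetric

theorem exists_transpose_mul_mul_eq_one {ι : Type*} [Fintype ι] [DecidableEq ι] {A : Matrix ι ι ℝ}
    (hA : A.PosDef) : ∃ X : Matrix ι ι ℝ, Xᵀ * A * X = 1 := by
  open scoped MatrixOrder Matrix.Norms.L2Operator in
  obtain ⟨Y, hY⟩ := CStarAlgebra.nonneg_iff_eq_star_mul_self.mp hA.posSemidef.nonneg
  have hAY : A = Yᵀ * Y := by simpa [star_eq_conjTranspose] using hY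
  have hdet : IsUnit Y.det := by
    have hAdet := (isUnit_iff_isUnit_det _).1 hA.isUnit
    rw [hAY, det_mul] at hAdet
    exact isUnit_of_mul_isUnit_right hAdet
  refine ⟨Y⁻¹, ?_⟩
  rw [hAY, ← Matrix.mul_assoc, ← transpose_mul, mul_nonsing_inv _ hdet, transpose_one,
    Matrix.one_mul, mul_nonsing_inv _ hdet]

-- A solution of `C' = -B C` is parallel along the `r`-lines, so it stays orthonormal.
theorem isBrinkmannFrame_of_matDeriv_eq (h : IsSmoothMetric gbar) (hC : IsSmoothMatrix C)
    (hC' : ∀ u, matDeriv C u = -(shapeOp gbar u * C u)) {u₀ : ℝ}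
    (h₀ : (C u₀)ᵀ * gbar u₀ * C u₀ = 1) : IsBrinkmannFrame gbar C := by
  have hleft : ∀ u, (matDeriv C u)ᵀ * gbar u * C u = -((C u)ᵀ * (gbar u * shapeOp gbar u) * C u) :=
    fun u => by
      rw [hC', ← h.isSymm_mul_shapeOp u]
      simp only [transpose_neg, transpose_mul, (h.isSymm u).eq, Matrix.neg_mul, Matrix.mul_assoc]
  have hright : ∀ u, (C u)ᵀ * gbar u * matDeriv C u = -((C u)ᵀ * (gbar u * shapeOp gbar u) * C u) :=
    fun u => by simp only [hC', Matrix.mul_neg, Matrix.mul_assoc]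
  refine ⟨hC, fun u => ?_, fun u => (hleft u).trans (hright u).symm⟩
  rw [← h₀]
  refine eq_of_matDeriv_eq_zero ((hC.transpose.mul h.smooth).mul hC) (fun s => ?_) u u₀
  rw [matDeriv_mul (hC.transpose.mul h.smooth) hC, matDeriv_mul hC.transpose h.smooth,
    matDeriv_transpose, Matrix.add_mul, hleft, hright, h.matDeriv_eq_two_smul, Matrix.mul_smul,
    Matrix.smul_mul]
  module

theorem exists_isBrinkmannFrame (h : IsSmoothMetric gbar) {u₀ : ℝ} (h₀ : (gbar u₀).PosDef) :
    ∃ C, IsBrinkmannFrame gbar C := by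
  obtain ⟨C₀, hC₀⟩ := exists_transpose_mul_mul_eq_one h₀
  obtain ⟨C, hC, rfl, hC'⟩ := exists_matDeriv_eq_mul h.isSmoothMatrix_shapeOp.neg u₀ C₀
  exact ⟨C, isBrinkmannFrame_of_matDeriv_eq h hC (fun u => by rw [hC', Matrix.neg_mul]) hC₀⟩

namespace IsBrinkmannFrame

variable (hC : IsBrinkmannFrame gbar C)
include hC

theorem isSmoothMatrix : IsSmoothMatrix C := hC.smooth

theorem mul_mul_transpose (u : ℝ) : gbar u * C u * (C u)ᵀ = 1 := by
  rw [mul_eq_one_comm, ← Matrix.mul_assoc, hC.orthonormal]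

theorem mul_transpose_mul (u : ℝ) : C u * ((C u)ᵀ * gbar u) = 1 :=
  mul_eq_one_comm.1 (hC.orthonormal u)

theorem eq_inv (u : ℝ) : gbar u = (C u * (C u)ᵀ)⁻¹ :=
  (inv_eq_left_inv (by rw [← Matrix.mul_assoc, hC.mul_mul_transpose])).symm

theorem isSmoothMetric : IsSmoothMetric gbar where
  smooth := by
    rw [funext hC.eq_inv]
    refine (hC.isSmoothMatrix.mul hC.isSmoothMatrix.transpose).inv fun u => ?_
    exact .of_mul_eq_one (gbar u) (by rw [Matrix.mul_assoc, hC.mul_transpose_mul])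
  isSymm u := by
    rw [hC.eq_inv, Matrix.IsSymm, transpose_nonsing_inv, transpose_mul, transpose_transpose]
  isUnit u := .of_mul_eq_one (C u * (C u)ᵀ) (by rw [← Matrix.mul_assoc, hC.mul_mul_transpose])

theorem matDeriv_eq (u : ℝ) : matDeriv C u = -(shapeOp gbar u * C u) := by
  have h := hC.isSmoothMetric
  have deriv_orthonormal : matDeriv (fun u => (C u)ᵀ * gbar u * C u) u = 0 := by
    rw [funext hC.orthonormal, matDeriv_const]
  have two_smul_eq_zero :
      (2 : ℝ) • ((C u)ᵀ * gbar u * (matDeriv C u + shapeOp gbar u * C u)) = 0 := by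
    rw [← deriv_orthonormal, matDeriv_mul (hC.isSmoothMatrix.transpose.mul h.smooth)
      hC.isSmoothMatrix, matDeriv_mul hC.isSmoothMatrix.transpose h.smooth, matDeriv_transpose,
      Matrix.add_mul, hC.symm, h.matDeriv_eq_two_smul]
    simp only [Matrix.mul_add, Matrix.mul_smul, Matrix.smul_mul, Matrix.mul_assoc]
    module
  rw [← add_eq_zero_iff_eq_neg, ← Matrix.one_mul (matDeriv C u + _), ← hC.mul_transpose_mul u,
    Matrix.mul_assoc, (smul_eq_zero.1 two_smul_eq_zero).resolve_left two_ne_zero, Matrix.mul_zero]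

theorem matDeriv_mul_matDeriv (u : ℝ) :
    matDeriv (fun s => gbar s * matDeriv C s) u = gbar u * jacobiOp gbar u * C u := by
  have h := hC.isSmoothMetric
  have hB := h.isSmoothMatrix_shapeOp
  rw [matDeriv_mul h.smooth hC.isSmoothMatrix.matDeriv, funext hC.matDeriv_eq, matDeriv_neg,
    matDeriv_mul hB hC.isSmoothMatrix, hC.matDeriv_eq, h.matDeriv_eq_two_smul, jacobiOp]
  simp only [Matrix.mul_add, Matrix.add_mul, Matrix.mul_neg, Matrix.neg_mul, Matrix.smul_mul,
    Matrix.mul_assoc]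
  module

theorem profileMatrix_eq (u : ℝ) :
    profileMatrix gbar C u = (C u)ᵀ * jacobiForm gbar u * C u := by
  rw [profileMatrix, hC.matDeriv_mul_matDeriv, jacobiForm, transpose_mul, transpose_mul,
    (hC.isSmoothMetric.isSymm u).eq]

theorem trace_profileMatrix (u : ℝ) : (profileMatrix gbar C u).trace = (jacobiOp gbar u).trace := by
  rw [hC.profileMatrix_eq, jacobiForm, Matrix.mul_assoc, trace_mul_comm, Matrix.mul_assoc,
    Matrix.mul_assoc, ← Matrix.mul_assoc (gbar u), hC.mul_mul_transpose, Matrix.mul_one,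
    trace_transpose]

theorem matDeriv_transpose_mul_mul (hW : IsSmoothMatrix W) (u : ℝ) :
    matDeriv (fun s => (C s)ᵀ * W s * C s) u = (C u)ᵀ * covDerivForm gbar W u * C u := by
  rw [matDeriv_mul (hC.isSmoothMatrix.transpose.mul hW) hC.isSmoothMatrix,
    matDeriv_mul hC.isSmoothMatrix.transpose hW, matDeriv_transpose, hC.matDeriv_eq, covDerivForm]
  simp only [transpose_neg, transpose_mul, Matrix.mul_sub, Matrix.sub_mul, Matrix.add_mul,
    Matrix.mul_neg, Matrix.neg_mul, Matrix.mul_assoc]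
  abel

theorem isSmoothMatrix_profileMatrix : IsSmoothMatrix (profileMatrix gbar C) :=
  (hC.isSmoothMetric.smooth.mul hC.isSmoothMatrix.matDeriv).matDeriv.transpose.mul hC.isSmoothMatrix

theorem matDeriv_profileMatrix (u : ℝ) : matDeriv (profileMatrix gbar C) u =
    (C u)ᵀ * covDerivForm gbar (jacobiForm gbar) u * C u := by
  rw [funext hC.profileMatrix_eq,
    hC.matDeriv_transpose_mul_mul hC.isSmoothMetric.isSmoothMatrix_jacobiForm]

end IsBrinkmannFrame

end BrinkmannFrames

section PullbackMetric

open Matrix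

variable {ι : Type*} [Fintype ι] [DecidableEq ι]

theorem lineDeriv_apply_eq_partialD {Φ : (ι → ℝ) → ι → ℝ} {p : ι → ℝ}
    (hΦ : DifferentiableAt ℝ Φ p) (a c : ι) :
    lineDeriv ℝ Φ p (Pi.single a 1) c = partialD a (fun q => Φ q c) p := by
  rw [hΦ.lineDeriv_eq_fderiv, partialD, (hasFDerivAt_pi'.1 hΦ.hasFDerivAt c).fderiv]
  rfl

theorem pullbackMetric_eq_of_hasLineDerivAt {Φ : (ι → ℝ) → ι → ℝ}
    {dΦ : (ι → ℝ) → (ι → ℝ) → ι → ℝ} {g g' : (ι → ℝ) → Matrix ι ι ℝ} (hΦ : Differentiable ℝ Φ)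
    (hdΦ : ∀ p w, HasLineDerivAt ℝ Φ (dΦ p w) p w)
    (isometry : ∀ p w w', dΦ p w ⬝ᵥ g (Φ p) *ᵥ dΦ p w' = w ⬝ᵥ g' p *ᵥ w') :
    pullbackMetric Φ g = g' := by
  have partialD_eq : ∀ p a c, partialD a (fun q => Φ q c) p = dΦ p (Pi.single a 1) c :=
    fun p a c => by rw [← lineDeriv_apply_eq_partialD (hΦ p), (hdΦ p _).lineDeriv]
  funext p
  ext a b
  have entry : g' p a b = Pi.single a 1 ⬝ᵥ g' p *ᵥ Pi.single b 1 := by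
    rw [mulVec_single_one, single_one_dotProduct, col_apply]
  rw [entry, ← isometry]
  simp only [pullbackMetric, of_apply, partialD_eq, dotProduct, mulVec, Finset.mul_sum]
  exact Finset.sum_congr rfl fun c _ => Finset.sum_congr rfl fun d _ => by ring

end PullbackMetric

section BrinkmannCoordinates

open Matrix

variable {m : ℕ} {gbar C : ℝ → Matrix (Fin m) (Fin m) ℝ}

theorem contDiff_sumElim_vec {E : Type*} [NormedAddCommGroup E] [NormedSpace ℝ E] {a b : E → ℝ}
    {x : E → Fin m → ℝ} (ha : ContDiff ℝ ∞ a) (hb : ContDiff ℝ ∞ b) (hx : ContDiff ℝ ∞ x) :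
    ContDiff ℝ ∞ fun p => Sum.elim ![a p, b p] (x p) :=
  contDiff_pi.2 <| Sum.forall.2 ⟨Fin.forall_fin_two.2 ⟨ha, hb⟩, contDiff_pi.1 hx⟩

theorem hasDerivAt_sumElim_vec {a b : ℝ → ℝ} {x : ℝ → Fin m → ℝ} {a' b' t : ℝ} {x' : Fin m → ℝ}
    (ha : HasDerivAt a a' t) (hb : HasDerivAt b b' t) (hx : HasDerivAt x x' t) :
    HasDerivAt (fun s => Sum.elim ![a s, b s] (x s)) (Sum.elim ![a', b'] x') t :=
  hasDerivAt_pi.2 <| Sum.forall.2 ⟨Fin.forall_fin_two.2 ⟨ha, hb⟩, hasDerivAt_pi.1 hx⟩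

theorem mulVec_dotProduct_mulVec {ι κ μ ν : Type*} [Fintype ι] [Fintype κ] [Fintype μ] [Fintype ν]
    (A : Matrix ι κ ℝ) (D : Matrix ι μ ℝ) (B : Matrix μ ν ℝ) (x : κ → ℝ) (y : ν → ℝ) :
    (A *ᵥ x) ⬝ᵥ D *ᵥ B *ᵥ y = x ⬝ᵥ (Aᵀ * D * B) *ᵥ y := by
  rw [← mulVec_mulVec, ← mulVec_mulVec, dotProduct_mulVec x, vecMul_transpose]

/-- The symmetric bilinear form `gbar(∂_u C ·, C ·)`, by which `brinkmannToRosen` shifts `v`. -/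
def frameForm (gbar C : ℝ → Matrix (Fin m) (Fin m) ℝ) (u : ℝ) : Matrix (Fin m) (Fin m) ℝ :=
  (matDeriv C u)ᵀ * gbar u * C u

theorem brinkmannToRosen_eq (gbar C : ℝ → Matrix (Fin m) (Fin m) ℝ) (p : Fin 2 ⊕ Fin m → ℝ) :
    brinkmannToRosen gbar C p = Sum.elim
      ![p (.inl 1), p (.inl 0) -
        1 / 2 * ((p ∘ Sum.inr) ⬝ᵥ frameForm gbar C (p (.inl 1)) *ᵥ (p ∘ Sum.inr))]
      (C (p (.inl 1)) *ᵥ (p ∘ Sum.inr)) := by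
  rw [frameForm, ← mulVec_dotProduct_mulVec, brinkmannToRosen]
  have expand : ∀ u (x : Fin m → ℝ), ∑ i, ∑ j, ∑ k, ∑ l,
      gbar u i j * matDeriv C u i k * C u j l * x k * x l =
        (matDeriv C u *ᵥ x) ⬝ᵥ gbar u *ᵥ C u *ᵥ x := fun u x => by
    simp only [dotProduct, mulVec, Finset.mul_sum, Finset.sum_mul]
    refine Finset.sum_congr rfl fun i _ => Finset.sum_congr rfl fun j _ => ?_
    rw [Finset.sum_comm]
    exact Finset.sum_congr rfl fun l _ => Finset.sum_congr rfl fun k _ => by ring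
  rw [← expand]
  rfl

theorem profile_eq (hsymm : ∀ r, (gbar r).IsSymm) (u : ℝ) (x : EuclideanSpace ℝ (Fin m)) :
    profile gbar C u x = -(x.ofLp ⬝ᵥ profileMatrix gbar C u *ᵥ x.ofLp) := by
  have deriv_eq : ∀ j k, deriv (fun s => ∑ i, gbar s i j * matDeriv C s i k) u =
      matDeriv (fun s => gbar s * matDeriv C s) u j k := fun j k => by
    simp only [matDeriv, of_apply, mul_apply]
    simp only [fun s i => (hsymm s).apply j i]
  rw [profileMatrix, ← mulVec_mulVec, dotProduct_mulVec, vecMul_transpose, profile]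
  simp only [deriv_eq, dotProduct, mulVec, Finset.sum_mul_sum]
  refine congrArg _ (Finset.sum_congr rfl fun j _ => Finset.sum_congr rfl fun k _ =>
    Finset.sum_congr rfl fun l _ => ?_)
  ring

/-- The inverse of `brinkmannToRosen`: since `C` is orthonormal, its inverse is `Cᵀ gbar`. -/
def rosenToBrinkmann (gbar C : ℝ → Matrix (Fin m) (Fin m) ℝ) (q : Fin 2 ⊕ Fin m → ℝ) :
    Fin 2 ⊕ Fin m → ℝ :=
  let x : Fin m → ℝ := ((C (q (.inl 0)))ᵀ * gbar (q (.inl 0))) *ᵥ (q ∘ Sum.inr)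
  Sum.elim ![q (.inl 1) + 1 / 2 * (x ⬝ᵥ frameForm gbar C (q (.inl 0)) *ᵥ x), q (.inl 0)] x

/-- The differential of `brinkmannToRosen` at `p`, applied to `w`. -/
def brinkmannToRosenDeriv (gbar C : ℝ → Matrix (Fin m) (Fin m) ℝ) (p w : Fin 2 ⊕ Fin m → ℝ) :
    Fin 2 ⊕ Fin m → ℝ :=
  let u : ℝ := p (.inl 1)
  let x : Fin m → ℝ := p ∘ Sum.inr
  Sum.elim
    ![w (.inl 1), w (.inl 0) - 1 / 2 * w (.inl 1) * (x ⬝ᵥ matDeriv (frameForm gbar C) u *ᵥ x) -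
      x ⬝ᵥ frameForm gbar C u *ᵥ (w ∘ Sum.inr)]
    (w (.inl 1) • matDeriv C u *ᵥ x + C u *ᵥ (w ∘ Sum.inr))

theorem dotProduct_fromBlocks_mulVec (H : ℝ) (G : Matrix (Fin m) (Fin m) ℝ)
    (w w' : Fin 2 ⊕ Fin m → ℝ) :
    w ⬝ᵥ fromBlocks !![0, 1; 1, H] 0 0 G *ᵥ w' =
      w (.inl 0) * w' (.inl 1) + w (.inl 1) * w' (.inl 0) + H * w (.inl 1) * w' (.inl 1) +
        (w ∘ Sum.inr) ⬝ᵥ G *ᵥ (w' ∘ Sum.inr) := by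
  simp only [dotProduct, Fintype.sum_sum_type, fromBlocks_mulVec, zero_mulVec, add_zero, zero_add,
    Sum.elim_inl, Sum.elim_inr, Fin.sum_univ_two, mulVec_fin_two, cons_val_zero, cons_val_one,
    Function.comp_apply, of_apply]
  ring

namespace IsBrinkmannFrame

variable (hC : IsBrinkmannFrame gbar C)
include hC

theorem frameForm_eq_transpose_mul (u : ℝ) :
    frameForm gbar C u = (gbar u * matDeriv C u)ᵀ * C u := by
  rw [frameForm, transpose_mul, (hC.isSmoothMetric.isSymm u).eq]

theorem isSymm_frameForm (u : ℝ) : (frameForm gbar C u).IsSymm := by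
  rw [Matrix.IsSymm, hC.frameForm_eq_transpose_mul, transpose_mul, transpose_transpose,
    ← Matrix.mul_assoc, ← hC.symm, ← frameForm, hC.frameForm_eq_transpose_mul]

theorem isSmoothMatrix_frameForm : IsSmoothMatrix (frameForm gbar C) :=
  (hC.isSmoothMatrix.matDeriv.transpose.mul hC.isSmoothMetric.smooth).mul hC.isSmoothMatrix

theorem matDeriv_frameForm (u : ℝ) : matDeriv (frameForm gbar C) u =
    profileMatrix gbar C u + (matDeriv C u)ᵀ * gbar u * matDeriv C u := by
  have h := hC.isSmoothMetric
  have hgC' : IsSmoothMatrix fun s => gbar s * matDeriv C s :=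
    h.smooth.mul hC.isSmoothMatrix.matDeriv
  rw [funext hC.frameForm_eq_transpose_mul, matDeriv_mul hgC'.transpose hC.isSmoothMatrix,
    matDeriv_transpose, transpose_mul, (h.isSymm u).eq, profileMatrix]

theorem contDiff_brinkmannToRosen : ContDiff ℝ ∞ (brinkmannToRosen gbar C) := by
  rw [funext (brinkmannToRosen_eq gbar C)]
  have hu : ContDiff ℝ ∞ fun p : Fin 2 ⊕ Fin m → ℝ => p (.inl 1) := contDiff_apply ℝ ℝ _
  have hv : ContDiff ℝ ∞ fun p : Fin 2 ⊕ Fin m → ℝ => p (.inl 0) := contDiff_apply ℝ ℝ _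
  have hx : ContDiff ℝ ∞ fun p : Fin 2 ⊕ Fin m → ℝ => p ∘ Sum.inr :=
    contDiff_pi.2 fun i => contDiff_apply ℝ ℝ _
  have hSx := (hC.isSmoothMatrix_frameForm.comp hu).mulVec hx
  exact contDiff_sumElim_vec hu (hv.sub (contDiff_const.mul (contDiff_dotProduct hx hSx)))
    ((hC.isSmoothMatrix.comp hu).mulVec hx)

theorem contDiff_rosenToBrinkmann : ContDiff ℝ ∞ (rosenToBrinkmann gbar C) := by
  have hr : ContDiff ℝ ∞ fun q : Fin 2 ⊕ Fin m → ℝ => q (.inl 0) := contDiff_apply ℝ ℝ _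
  have ht : ContDiff ℝ ∞ fun q : Fin 2 ⊕ Fin m → ℝ => q (.inl 1) := contDiff_apply ℝ ℝ _
  have hx : ContDiff ℝ ∞ fun q : Fin 2 ⊕ Fin m → ℝ =>
      ((C (q (.inl 0)))ᵀ * gbar (q (.inl 0))) *ᵥ (q ∘ Sum.inr) :=
    ((hC.isSmoothMatrix.transpose.mul hC.isSmoothMetric.smooth).comp hr).mulVec
      (contDiff_pi.2 fun i => contDiff_apply ℝ ℝ _)
  have hSx := (hC.isSmoothMatrix_frameForm.comp hr).mulVec hx
  exact contDiff_sumElim_vec (ht.add (contDiff_const.mul (contDiff_dotProduct hx hSx))) hr hx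

theorem leftInverse_rosenToBrinkmann :
    Function.LeftInverse (rosenToBrinkmann gbar C) (brinkmannToRosen gbar C) := fun p => by
  rw [brinkmannToRosen_eq]
  funext a
  rcases a with a | i
  · fin_cases a <;> simp [rosenToBrinkmann, hC.orthonormal]
  · simp [rosenToBrinkmann, hC.orthonormal]

theorem rightInverse_rosenToBrinkmann :
    Function.RightInverse (rosenToBrinkmann gbar C) (brinkmannToRosen gbar C) := fun q => by
  rw [brinkmannToRosen_eq]
  funext a
  rcases a with a | i
  · fin_cases a <;> simp [rosenToBrinkmann]
  · simp [rosenToBrinkmann, hC.mul_transpose_mul]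

theorem isSmoothDiffeo_brinkmannToRosen : IsSmoothDiffeo (brinkmannToRosen gbar C) :=
  ⟨hC.contDiff_brinkmannToRosen, rosenToBrinkmann gbar C, hC.contDiff_rosenToBrinkmann,
    hC.leftInverse_rosenToBrinkmann, hC.rightInverse_rosenToBrinkmann⟩

theorem dotProduct_frameForm_mulVec_comm (u : ℝ) (x y : Fin m → ℝ) :
    x ⬝ᵥ frameForm gbar C u *ᵥ y = y ⬝ᵥ frameForm gbar C u *ᵥ x := by
  rw [dotProduct_mulVec, ← mulVec_transpose, (hC.isSymm_frameForm u).eq, dotProduct_comm]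

theorem hasDerivAt_half_frameForm_quadratic {f : ℝ → ℝ} {x : ℝ → Fin m → ℝ} {f' t : ℝ}
    {x' : Fin m → ℝ}
    (hf : HasDerivAt f f' t) (hx : HasDerivAt x x' t) :
    HasDerivAt (fun s => 1 / 2 * (x s ⬝ᵥ frameForm gbar C (f s) *ᵥ x s))
      (1 / 2 * f' * (x t ⬝ᵥ matDeriv (frameForm gbar C) (f t) *ᵥ x t) +
        x t ⬝ᵥ frameForm gbar C (f t) *ᵥ x') t := by
  refine ((hasDerivAt_dotProduct hx (hasDerivAt_mulVec hC.isSmoothMatrix_frameForm hf hx)).const_mul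
    (1 / 2)).congr_deriv ?_
  rw [hC.dotProduct_frameForm_mulVec_comm _ x', dotProduct_add, dotProduct_smul, smul_eq_mul]
  ring

theorem hasLineDerivAt_brinkmannToRosen (p w : Fin 2 ⊕ Fin m → ℝ) :
    HasLineDerivAt ℝ (brinkmannToRosen gbar C) (brinkmannToRosenDeriv gbar C p w) p w := by
  have hc : HasDerivAt (fun t : ℝ => p + t • w) w 0 := by
    simpa using ((hasDerivAt_id (0 : ℝ)).smul_const w).const_add p
  have hu := hasDerivAt_pi.1 hc (.inl 1)
  have hv := hasDerivAt_pi.1 hc (.inl 0)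
  have hx : HasDerivAt (fun t : ℝ => (p + t • w) ∘ Sum.inr) (w ∘ Sum.inr) 0 :=
    hasDerivAt_pi.2 fun i => hasDerivAt_pi.1 hc (.inr i)
  have h := hasDerivAt_sumElim_vec hu (hv.fun_sub (hC.hasDerivAt_half_frameForm_quadratic hu hx))
    (hasDerivAt_mulVec hC.isSmoothMatrix hu hx)
  rw [HasLineDerivAt, brinkmannToRosenDeriv]
  simp only [brinkmannToRosen_eq]
  simpa only [zero_smul, add_zero, sub_sub] using h

theorem transverse_dotProduct_mulVec (u a b : ℝ) (x y z : Fin m → ℝ) :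
    (a • matDeriv C u *ᵥ x + C u *ᵥ y) ⬝ᵥ gbar u *ᵥ (b • matDeriv C u *ᵥ x + C u *ᵥ z) =
      a * b * (x ⬝ᵥ ((matDeriv C u)ᵀ * gbar u * matDeriv C u) *ᵥ x) +
        a * (x ⬝ᵥ frameForm gbar C u *ᵥ z) + b * (x ⬝ᵥ frameForm gbar C u *ᵥ y) + y ⬝ᵥ z := by
  have hS : (C u)ᵀ * gbar u * matDeriv C u = frameForm gbar C u := (hC.symm u).symm
  have hS' : (matDeriv C u)ᵀ * gbar u * C u = frameForm gbar C u := rfl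
  rw [hC.dotProduct_frameForm_mulVec_comm u x y]
  simp only [mulVec_add, mulVec_smul, dotProduct_add, add_dotProduct, smul_dotProduct,
    dotProduct_smul, smul_eq_mul, mulVec_dotProduct_mulVec, hC.orthonormal, one_mulVec, hS, hS']
  ring

theorem dotProduct_planeWave_mulVec_brinkmannToRosenDeriv (p w w' : Fin 2 ⊕ Fin m → ℝ) :
    brinkmannToRosenDeriv gbar C p w ⬝ᵥ
        planeWave gbar (brinkmannToRosen gbar C p) *ᵥ brinkmannToRosenDeriv gbar C p w' =
      w ⬝ᵥ brinkmannMetric (profile gbar C) p *ᵥ w' := by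
  rw [planeWave, brinkmannMetric, dotProduct_fromBlocks_mulVec, dotProduct_fromBlocks_mulVec,
    profile_eq hC.isSmoothMetric.isSymm, brinkmannToRosen_eq, brinkmannToRosenDeriv,
    brinkmannToRosenDeriv, hC.matDeriv_frameForm]
  simp only [Sum.elim_inl, Sum.elim_comp_inr, cons_val_zero, cons_val_one,
    hC.transverse_dotProduct_mulVec, add_mulVec, dotProduct_add, one_mulVec]
  simp only [Function.comp_def]
  ring

theorem pullbackMetric_brinkmannToRosen :
    pullbackMetric (brinkmannToRosen gbar C) (planeWave gbar) =
      brinkmannMetric (profile gbar C) :=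
  pullbackMetric_eq_of_hasLineDerivAt (hC.contDiff_brinkmannToRosen.differentiable (by simp))
    hC.hasLineDerivAt_brinkmannToRosen hC.dotProduct_planeWave_mulVec_brinkmannToRosenDeriv

end IsBrinkmannFrame

end BrinkmannCoordinates

section QuadraticForms

open Matrix

theorem iteratedFDeriv_two_bilin_self {E : Type*} [NormedAddCommGroup E] [NormedSpace ℝ E]
    (B : E →L[ℝ] E →L[ℝ] ℝ) (x v w : E) :
    iteratedFDeriv ℝ 2 (fun y => B y y) x ![v, w] = B v w + B w v := by
  have hderiv : fderiv ℝ (fun y => B y y) = ⇑(B + B.flip) := by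
    funext y
    refine (B.hasFDerivAt_of_bilinear (hasFDerivAt_id y) (hasFDerivAt_id y)).fderiv.trans ?_
    ext z
    simp
  rw [iteratedFDeriv_two_apply, hderiv, ContinuousLinearMap.fderiv]
  simp

variable {m : ℕ}

theorem iteratedFDeriv_two_neg_dotProduct_mulVec (N : Matrix (Fin m) (Fin m) ℝ)
    (x : EuclideanSpace ℝ (Fin m)) (i j : Fin m) :
    iteratedFDeriv ℝ 2 (fun y : EuclideanSpace ℝ (Fin m) => -(y.ofLp ⬝ᵥ N *ᵥ y.ofLp)) x
        ![EuclideanSpace.single i 1, EuclideanSpace.single j 1] = -(N i j + N j i) := by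
  let B : EuclideanSpace ℝ (Fin m) →L[ℝ] EuclideanSpace ℝ (Fin m) →L[ℝ] ℝ :=
    LinearMap.toContinuousBilinearMap <|
      (-toLinearMap₂' ℝ N).compl₁₂ (WithLp.linearEquiv 2 ℝ (Fin m → ℝ)).toLinearMap
        (WithLp.linearEquiv 2 ℝ (Fin m → ℝ)).toLinearMap
  have hB : ∀ y z, B y z = -(y.ofLp ⬝ᵥ N *ᵥ z.ofLp) := fun y z => by
    simp [B, toLinearMap₂'_apply']
  simp only [← hB]
  rw [iteratedFDeriv_two_bilin_self, hB, hB]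
  simp [add_comm]

variable {gbar C : ℝ → Matrix (Fin m) (Fin m) ℝ}

namespace IsBrinkmannFrame

variable (hC : IsBrinkmannFrame gbar C)
include hC

theorem spatialHessian_profile (i j : Fin m) (u : ℝ) (x : EuclideanSpace ℝ (Fin m)) :
    spatialHessian (profile gbar C) i j u x =
      -(profileMatrix gbar C u i j + profileMatrix gbar C u j i) := by
  rw [spatialHessian, funext (profile_eq hC.isSmoothMetric.isSymm u),
    iteratedFDeriv_two_neg_dotProduct_mulVec]

theorem laplacian_profile (u : ℝ) (x : EuclideanSpace ℝ (Fin m)) :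
    Laplacian.laplacian (profile gbar C u) x = -2 * (jacobiOp gbar u).trace := by
  rw [InnerProductSpace.laplacian_eq_iteratedFDeriv_orthonormalBasis _
    (EuclideanSpace.basisFun (Fin m) ℝ), ← hC.trace_profileMatrix, trace, Finset.mul_sum]
  refine Finset.sum_congr rfl fun i _ => ?_
  have hessian := hC.spatialHessian_profile i i u x
  rw [spatialHessian] at hessian
  rw [EuclideanSpace.basisFun_apply, hessian, diag_apply]
  ring

theorem deriv_spatialHessian_profile (i j : Fin m) (u : ℝ) (x : EuclideanSpace ℝ (Fin m)) :
    deriv (fun s => spatialHessian (profile gbar C) i j s x) u =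
      -(matDeriv (profileMatrix gbar C) u i j + matDeriv (profileMatrix gbar C) u j i) := by
  have hN := hC.isSmoothMatrix_profileMatrix
  simp only [hC.spatialHessian_profile]
  exact ((hN.hasDerivAt u i j).add (hN.hasDerivAt u j i)).neg.deriv

end IsBrinkmannFrame

end QuadraticForms

section Curvature

variable {ι : Type*} [DecidableEq ι]

theorem partialD_const (i : ι) (c : ℝ) (p : ι → ℝ) : partialD i (fun _ => c) p = 0 := by
  rw [partialD, fderiv_fun_const]
  rfl

variable [Fintype ι] {g : (ι → ℝ) → Matrix ι ι ℝ}

theorem contDiff_partialD {f : (ι → ℝ) → ℝ} (hf : ContDiff ℝ ∞ f) (i : ι) :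
    ContDiff ℝ ∞ (partialD i f) :=
  (hf.fderiv_right (by simp)).clm_apply contDiff_const

theorem christoffel_comm (hg : ∀ p, (g p).IsSymm) (k i j : ι) :
    christoffel g k i j = christoffel g k j i := by
  funext p
  simp only [christoffel, fun q => (hg q).apply j i, add_comm (partialD i _ p)]

namespace IsSmoothMetric

variable (hg : IsSmoothMetric g)
include hg

theorem contDiff_christoffel (k i j : ι) : ContDiff ℝ ∞ (christoffel g k i j) :=
  contDiff_const.mul <| ContDiff.sum fun l _ => (hg.smooth.inv hg.isUnit k l).mul
    (((contDiff_partialD (hg.smooth j l) i).add (contDiff_partialD (hg.smooth i l) j)).sub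
      (contDiff_partialD (hg.smooth i j) l))

theorem contDiff_curvEndo (i j k l : ι) : ContDiff ℝ ∞ (curvEndo g i j k l) :=
  ((contDiff_partialD (hg.contDiff_christoffel l j k) i).sub
    (contDiff_partialD (hg.contDiff_christoffel l i k) j)).add <| ContDiff.sum fun m _ =>
      ((hg.contDiff_christoffel l i m).mul (hg.contDiff_christoffel m j k)).sub
        ((hg.contDiff_christoffel l j m).mul (hg.contDiff_christoffel m i k))

theorem contDiff_riem (i j k l : ι) : ContDiff ℝ ∞ (riem g i j k l) :=
  ContDiff.sum fun m _ => (hg.contDiff_curvEndo i j k m).mul (hg.smooth m l)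

theorem contDiff_ricci (j k : ι) : ContDiff ℝ ∞ (ricci g j k) :=
  ContDiff.sum fun i _ => hg.contDiff_curvEndo i j k i

end IsSmoothMetric

end Curvature

section GaussMetrics

open Matrix

variable {m : ℕ} {γ : (Fin 1 ⊕ Fin m → ℝ) → Matrix (Fin m) (Fin m) ℝ}

/-- The metric `dr² + γ_{ij}(r, x) dxⁱ dxʲ`, for which the `r`-lines are unit speed geodesics
orthogonal to the slices of constant `r`. -/
def gaussMetric (γ : (Fin 1 ⊕ Fin m → ℝ) → Matrix (Fin m) (Fin m) ℝ) :
    (Fin 1 ⊕ Fin m → ℝ) → Matrix (Fin 1 ⊕ Fin m) (Fin 1 ⊕ Fin m) ℝ :=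
  fun p => fromBlocks 1 0 0 (γ p)

/-- The point with coordinates `(r, x)`. -/
def slicePoint (r : ℝ) (x : Fin m → ℝ) : Fin 1 ⊕ Fin m → ℝ := Sum.elim (fun _ => r) x

theorem hasDerivAt_slicePoint (r : ℝ) (x : Fin m → ℝ) :
    HasDerivAt (fun s => slicePoint s x) (Pi.single (.inl 0) 1) r := by
  refine hasDerivAt_pi.2 (Sum.forall.2 ⟨fun a => ?_, fun i => ?_⟩)
  · rw [Subsingleton.elim a 0, Pi.single_eq_same]
    exact hasDerivAt_id r
  · rw [Pi.single_eq_of_ne Sum.inr_ne_inl]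
    exact hasDerivAt_const r (x i)

theorem partialD_slicePoint {f : (Fin 1 ⊕ Fin m → ℝ) → ℝ} (hf : ContDiff ℝ ∞ f) (r : ℝ)
    (x : Fin m → ℝ) :
    partialD (.inl 0) f (slicePoint r x) = deriv (fun s => f (slicePoint s x)) r :=
  ((hf.differentiable (by simp) _).hasFDerivAt.comp_hasDerivAt r
    (hasDerivAt_slicePoint r x)).deriv.symm

theorem christoffel_gaussMetric_rr (γ : (Fin 1 ⊕ Fin m → ℝ) → Matrix (Fin m) (Fin m) ℝ)
    (k : Fin 1 ⊕ Fin m) : christoffel (gaussMetric γ) k (.inl 0) (.inl 0) = fun _ => 0 := by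
  funext p
  simp [christoffel, gaussMetric, partialD_const]

namespace IsSmoothMetric

variable (hγ : IsSmoothMetric γ)
include hγ

theorem isSmoothMetric_gaussMetric : IsSmoothMetric (gaussMetric γ) where
  smooth := (IsSmoothMatrix.const 1).fromBlocks hγ.smooth
  isSymm p := isSymm_one.fromBlocks transpose_zero (hγ.isSymm p)
  isUnit p := isUnit_fromBlocks_zero₂₁.2 ⟨isUnit_one, hγ.isUnit p⟩

theorem inv_gaussMetric (p : Fin 1 ⊕ Fin m → ℝ) :
    (gaussMetric γ p)⁻¹ = fromBlocks 1 0 0 (γ p)⁻¹ := by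
  rw [gaussMetric, inv_fromBlocks_zero₂₁_of_isUnit_iff _ _ _
    (iff_of_true isUnit_one (hγ.isUnit p))]
  simp

theorem christoffel_gaussMetric_r_rx (i : Fin m) :
    christoffel (gaussMetric γ) (.inl 0) (.inl 0) (.inr i) = fun _ => 0 := by
  funext p
  simp only [christoffel, hγ.inv_gaussMetric]
  simp [gaussMetric, partialD_const]

theorem christoffel_gaussMetric_x_rx (l i : Fin m) (r : ℝ) (x : Fin m → ℝ) :
    christoffel (gaussMetric γ) (.inr l) (.inl 0) (.inr i) (slicePoint r x) =
      shapeOp (fun s => γ (slicePoint s x)) r l i := by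
  have deriv_eq : ∀ k, partialD (.inl 0) (fun q => γ q i k) (slicePoint r x) =
      matDeriv (fun s => γ (slicePoint s x)) r k i := fun k => by
    simp only [partialD_slicePoint (hγ.smooth i k), matDeriv, of_apply,
      fun s => (hγ.isSymm (slicePoint s x)).apply k i]
  simp only [christoffel, hγ.inv_gaussMetric]
  simp [gaussMetric, partialD_const, shapeOp, mul_apply, deriv_eq]

theorem curvEndo_gaussMetric_xrrx (i l : Fin m) (r : ℝ) (x : Fin m → ℝ) :
    curvEndo (gaussMetric γ) (.inr i) (.inl 0) (.inl 0) (.inr l) (slicePoint r x) =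
      jacobiOp (fun s => γ (slicePoint s x)) r l i := by
  have deriv_eq : partialD (.inl 0)
      (christoffel (gaussMetric γ) (.inr l) (.inl 0) (.inr i)) (slicePoint r x) =
        matDeriv (shapeOp fun s => γ (slicePoint s x)) r l i := by
    simp only [partialD_slicePoint (hγ.isSmoothMetric_gaussMetric.contDiff_christoffel _ _ _),
      hγ.christoffel_gaussMetric_x_rx, matDeriv, of_apply]
  simp only [curvEndo, Fintype.sum_sum_type, Fin.sum_univ_one, christoffel_gaussMetric_rr,
    christoffel_comm hγ.isSmoothMetric_gaussMetric.isSymm _ (.inr i) (.inl 0),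
    hγ.christoffel_gaussMetric_r_rx, hγ.christoffel_gaussMetric_x_rx, partialD_const, deriv_eq,
    jacobiOp, Matrix.neg_apply, Matrix.add_apply, mul_apply, mul_zero, zero_sub, zero_add,
    Finset.sum_neg_distrib, neg_add]

theorem ricci_gaussMetric_rr (r : ℝ) (x : Fin m → ℝ) :
    ricci (gaussMetric γ) (.inl 0) (.inl 0) (slicePoint r x) =
      (jacobiOp (fun s => γ (slicePoint s x)) r).trace := by
  have curvEndo_rrr : curvEndo (gaussMetric γ) (.inl 0) (.inl 0) (.inl 0) (.inl 0)
      (slicePoint r x) = 0 := by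
    simp [curvEndo]
  simp only [ricci, Fintype.sum_sum_type, Fin.sum_univ_one, curvEndo_rrr, zero_add,
    hγ.curvEndo_gaussMetric_xrrx, trace, diag_apply]

theorem riem_gaussMetric_xrrx (i l : Fin m) (r : ℝ) (x : Fin m → ℝ) :
    riem (gaussMetric γ) (.inr i) (.inl 0) (.inl 0) (.inr l) (slicePoint r x) =
      jacobiForm (fun s => γ (slicePoint s x)) r i l := by
  simp only [riem, Fintype.sum_sum_type, hγ.curvEndo_gaussMetric_xrrx, gaussMetric,
    fromBlocks_apply₁₂, fromBlocks_apply₂₂, Matrix.zero_apply, mul_zero, Finset.sum_const_zero,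
    zero_add, jacobiForm, mul_apply, transpose_apply]

theorem covDerivRicci_gaussMetric_rrr (r : ℝ) (x : Fin m → ℝ) :
    covDerivRicci (gaussMetric γ) (.inl 0) (.inl 0) (.inl 0) (slicePoint r x) =
      deriv (fun s => (jacobiOp (fun t => γ (slicePoint t x)) s).trace) r := by
  simp only [covDerivRicci, christoffel_gaussMetric_rr, zero_mul, add_zero, Finset.sum_const_zero,
    sub_zero, partialD_slicePoint (hγ.isSmoothMetric_gaussMetric.contDiff_ricci _ _),
    hγ.ricci_gaussMetric_rr]

theorem covDerivRiem_gaussMetric_rxrrx (i l : Fin m) (r : ℝ) (x : Fin m → ℝ) :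
    covDerivRiem (gaussMetric γ) (.inl 0) (.inr i) (.inl 0) (.inl 0) (.inr l)
        (slicePoint r x) = covDerivForm (fun s => γ (slicePoint s x))
      (jacobiForm fun s => γ (slicePoint s x)) r i l := by
  simp only [covDerivRiem, christoffel_gaussMetric_rr, Fintype.sum_sum_type, Fin.sum_univ_one,
    hγ.christoffel_gaussMetric_r_rx, hγ.christoffel_gaussMetric_x_rx, hγ.riem_gaussMetric_xrrx,
    partialD_slicePoint (hγ.isSmoothMetric_gaussMetric.contDiff_riem _ _ _ _), zero_mul, add_zero,
    zero_add, covDerivForm, Matrix.sub_apply, mul_apply, transpose_apply, matDeriv, of_apply,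
    Finset.sum_add_distrib, sub_sub, mul_comm (jacobiForm _ _ _ _)]

end IsSmoothMetric

end GaussMetrics

section RiemannianExtensions

open Matrix

variable {m : ℕ} {gbar C : ℝ → Matrix (Fin m) (Fin m) ℝ}
  {g : (Fin 1 ⊕ Fin m → ℝ) → Matrix (Fin 1 ⊕ Fin m) (Fin 1 ⊕ Fin m) ℝ}

theorem exists_eq_gaussMetric (hg : g ∈ riemannianExtensions gbar) :
    ∃ γ, IsSmoothMetric γ ∧ g = gaussMetric γ ∧ (fun r => γ (slicePoint r 0)) = gbar := by
  obtain ⟨⟨smooth, posDef⟩, γ, hγ, axis⟩ := hg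
  obtain rfl : g = gaussMetric γ := funext hγ
  have hγpos : ∀ p, (γ p).PosDef := fun p => (posDef p).submatrix Sum.inr_injective
  exact ⟨γ, ⟨fun i j => smooth (.inr i) (.inr j), fun p => (hγpos p).isHermitian,
    fun p => (hγpos p).isUnit⟩, rfl, funext axis⟩

namespace IsBrinkmannFrame

variable (hC : IsBrinkmannFrame gbar C) (hg : g ∈ riemannianExtensions gbar)
include hC hg

theorem laplacian_profile_eq_ricci (u : ℝ) (x : EuclideanSpace ℝ (Fin m)) :
    Laplacian.laplacian (profile gbar C u) x =
      -2 * ricci g (.inl 0) (.inl 0) (slicePoint u 0) := by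
  obtain ⟨γ, hγ, rfl, axis⟩ := exists_eq_gaussMetric hg
  rw [hC.laplacian_profile, hγ.ricci_gaussMetric_rr, axis]

theorem deriv_laplacian_profile_eq_covDerivRicci (u : ℝ) (x : EuclideanSpace ℝ (Fin m)) :
    deriv (fun s => Laplacian.laplacian (profile gbar C s) x) u =
      -2 * covDerivRicci g (.inl 0) (.inl 0) (.inl 0) (slicePoint u 0) := by
  obtain ⟨γ, hγ, rfl, axis⟩ := exists_eq_gaussMetric hg
  simp only [hC.laplacian_profile, deriv_const_mul_field, hγ.covDerivRicci_gaussMetric_rrr, axis]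

theorem matDeriv_profileMatrix_eq_covDerivRiem (u : ℝ) :
    matDeriv (profileMatrix gbar C) u = (C u)ᵀ * of (fun i l =>
      covDerivRiem g (.inl 0) (.inr i) (.inl 0) (.inl 0) (.inr l) (slicePoint u 0)) * C u := by
  obtain ⟨γ, hγ, rfl, axis⟩ := exists_eq_gaussMetric hg
  simp only [hC.matDeriv_profileMatrix, hγ.covDerivRiem_gaussMetric_rxrrx, axis]
  rfl

theorem deriv_spatialHessian_profile_eq_zero (hsymm : LocallySymmetric g) (i j : Fin m) (u : ℝ)
    (x : EuclideanSpace ℝ (Fin m)) :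
    deriv (fun s => spatialHessian (profile gbar C) i j s x) u = 0 := by
  have hN : matDeriv (profileMatrix gbar C) u = 0 := by
    ext k l
    simp [hC.matDeriv_profileMatrix_eq_covDerivRiem hg, mul_apply, hsymm _ _ _ _ _ _]
  rw [hC.deriv_spatialHessian_profile, hN, Matrix.zero_apply, Matrix.zero_apply, add_zero, neg_zero]

end IsBrinkmannFrame

end RiemannianExtensions

end PlaneWave

end

theorem theorem1 {m : ℕ} (gbar : ℝ → Matrix (Fin m) (Fin m) ℝ)
    (hsmooth : ∀ i j, ContDiff ℝ ∞ fun r => gbar r i j)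
    (hpos : ∀ r, (gbar r).PosDef) :
    (∃ C, PlaneWave.IsBrinkmannFrame gbar C) ∧
    ∀ C, PlaneWave.IsBrinkmannFrame gbar C →
      (PlaneWave.IsSmoothDiffeo (PlaneWave.brinkmannToRosen gbar C) ∧
        PlaneWave.pullbackMetric (PlaneWave.brinkmannToRosen gbar C) (PlaneWave.planeWave gbar) =
          PlaneWave.brinkmannMetric (PlaneWave.profile gbar C)) ∧
      ((∃ u x, deriv (fun s => Laplacian.laplacian (PlaneWave.profile gbar C s) x) u ≠ 0) →
        ∀ g ∈ PlaneWave.riemannianExtensions gbar, ¬ PlaneWave.ParallelRicci g) ∧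
      ((∃ u x, Laplacian.laplacian (PlaneWave.profile gbar C u) x ≠ 0) →
        ∀ g ∈ PlaneWave.riemannianExtensions gbar, ¬ PlaneWave.RicciFlat g) ∧
      ((∃ i j u x, deriv (fun s => PlaneWave.spatialHessian (PlaneWave.profile gbar C) i j s x) u
          ≠ 0) →
        ∀ g ∈ PlaneWave.riemannianExtensions gbar, ¬ PlaneWave.LocallySymmetric g) := by
  open PlaneWave in
  have hgbar : IsSmoothMetric gbar :=
    ⟨hsmooth, fun r => (hpos r).isHermitian, fun r => (hpos r).isUnit⟩
  refine ⟨exists_isBrinkmannFrame hgbar (hpos 0), fun C hC => ⟨⟨hC.isSmoothDiffeo_brinkmannToRosen,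
    hC.pullbackMetric_brinkmannToRosen⟩, ?_, ?_, ?_⟩⟩
  · rintro ⟨u, x, hu⟩ g hg hparallel
    exact hu (by rw [hC.deriv_laplacian_profile_eq_covDerivRicci hg, hparallel, mul_zero])
  · rintro ⟨u, x, hu⟩ g hg hflat
    exact hu (by rw [hC.laplacian_profile_eq_ricci hg, hflat, mul_zero])
  · rintro ⟨i, j, u, x, hu⟩ g hg hsymm
    exact hu (hC.deriv_spatialHessian_profile_eq_zero hg hsymm i j u x)
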